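/- Let $n \ge 5$ and let $L_1, L_2 \colon \mathbb{F}_{2^n} \to \mathbb{F}_{2^n}$ be nonzero $\mathbb{F}_2$-linear mappings. For an $\mathbb{F}_2$-linear mapping $L$ on $\mathbb{F}_{2^n}$ let $L^*$ denote its adjoint with respect to the bilinear form $\langle x, y\rangle = \mathrm{Tr}(xy)$, where $\mathrm{Tr}\colon \mathbb{F}_{2^n} \to \mathbb{F}_2$ is the absolute trace; that is, $\mathrm{Tr}(L(x)y) = \mathrm{Tr}(xL^*(y))$ for all $x, y \in \mathbb{F}_{2^n}$. Define $F \colon \mathbb{F}_{2^n} \to \mathbb{F}_{2^n}$ by $F(x) = L_1(x^{-1}) + L_2(x)$, with the convention $0^{-1} = 0$. If $F$ is a permutation of $\mathbb{F}_{2^n}$, then $\ker L_1$ and $\ker L_2$ are multiplicative translates of subfields of $\mathbb{F}_{2^n}$, i.e. each of them is of the form $a\,\mathbb{F}_{2^k}$ for some $a \in \mathbb{F}_{2^n}\setminus\{0\}$ and some positive integer $k \mid n$ (where $a$ and $k$ may differ for the two kernels). Moreover, $\ker L_1 = L_2^*(\ker L_1^*)$ and $\ker L_2 = L_1^*(\ker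 L_2^*)$. -/

import Mathlib

section TraceAdjoint

/-- The adjoint `L^*` of an `𝔽₂`-linear map `L` on a finite field of characteristic `2`, with
respect to the nondegenerate symmetric bilinear form `⟨x, y⟩ = Tr(x y)`, where `Tr` is the absolute
trace. -/
noncomputable def traceAdjoint {F : Type*} [Field F] [Finite F] [Algebra (ZMod 2) F]
    (L : F →ₗ[ZMod 2] F) : F →ₗ[ZMod 2] F :=
  (Algebra.traceForm (ZMod 2) F).leftAdjointOfNondegenerate
    (traceForm_nondegenerate (ZMod 2) F) L

/-- The defining property `Tr(L(x) y) = Tr(x L^*(y))` of the adjoint. -/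
theorem trace_traceAdjoint {F : Type*} [Field F] [Finite F] [Algebra (ZMod 2) F]
    (L : F →ₗ[ZMod 2] F) (x y : F) :
    Algebra.trace (ZMod 2) F (L x * y) = Algebra.trace (ZMod 2) F (x * traceAdjoint L y) := by
  have h := LinearMap.BilinForm.isAdjointPairLeftAdjointOfNondegenerate
    (Algebra.traceForm (ZMod 2) F) (traceForm_nondegenerate (ZMod 2) F) L y x
  simp only [Algebra.traceForm_apply] at h
  rw [mul_comm (L x), mul_comm x]
  exact h.symm

/-- A subset `S` of a field `F` with `2 ^ n` elements is a (multiplicative) translate of a subfield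
if `S = a 𝔽_{2^k}` for some `a ≠ 0` and some `k ∣ n`, where `𝔽_{2^k}` is the subfield of `F` with
`2 ^ k` elements. -/
def IsSubfieldTranslate {F : Type*} [Field F] (n : ℕ) (S : Set F) : Prop :=
  ∃ (a : F) (k : ℕ) (K : Subfield F),
    a ≠ 0 ∧ k ∣ n ∧ Nat.card K = 2 ^ k ∧ S = (fun x : F => a * x) '' (K : Set F)

end TraceAdjoint

/-! ### Absolute trace, and a quadratic form on the trace-zero hyperplane. -/

section TraceBasics

variable {F : Type*} [Field F] [Algebra (ZMod 2) F]

/-! Write A = L₁*, B = L₂*. For b ≠ 0 the component Tr(bF(x)) = Tr(A(b)x⁻¹ + B(b)x) is balanced, so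
the Kloosterman sum at A(b)B(b) vanishes whenever A(b) and B(b) are nonzero. A vanishing sum at a
forces Tr(a) = 0 and Q(a) = 0, where Q(b² + b) = Tr(b + b³) is a quadratic form on the trace-zero
hyperplane with polar form Tr(xy) (`isKloostermanNull_of_card`). Hence A(b)B(b) satisfies both
conditions for every b, and only this is used later.

Polarising the trace condition gives B(ker A) ⊆ (im A)^⊥ = ker L₁, with equality by dimension since
A and B have no common zero b ≠ 0. Polarising Q along ker A shows that ker L₁ is closed under (x, y)
↦ √(xy), which makes a nonzero kernel a translate of a subfield.

It remains to exclude ker L₁ = 0. Then A is invertible and M = BA⁻¹ satisfies Tr(bM(b)) = Q(bM(b)) =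
0 for all b. Write M as a linearized polynomial with coefficients aᵢ, i mod n. The third difference
of Q(bM(b)) gives relations between products of the aᵢ (`coeff_relation`), and these make the second
difference collapse to a linear identity (`secondDiffCoeff_relation`). Together they force M = 0 for
n ≥ 5, contradicting L₂ ≠ 0. The other kernel follows by substituting x⁻¹ for x. -/

theorem two_eq_zero_of_algebra_zmod_two (F : Type*) [Field F] [Algebra (ZMod 2) F] :
    (2 : F) = 0 := by
  have h : algebraMap (ZMod 2) F 2 = 0 := by
    rw [show (2 : ZMod 2) = 0 from rfl, map_zero]
  rwa [map_ofNat] at h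

theorem charP_two_of_algebra_zmod_two (F : Type*) [Field F] [Algebra (ZMod 2) F] : CharP F 2 :=
  charP_of_injective_algebraMap (algebraMap (ZMod 2) F).injective 2

theorem add_self_zmod_two_algebra (x : F) : x + x = 0 := by
  rw [← two_mul, two_eq_zero_of_algebra_zmod_two, zero_mul]

theorem eq_of_add_eq_zero_zmod_two_algebra {x y : F} (h : x + y = 0) : x = y := by
  linear_combination h - y * two_eq_zero_of_algebra_zmod_two F

variable [Finite F]

theorem trace_sq (x : F) : Algebra.trace (ZMod 2) F (x ^ 2) = Algebra.trace (ZMod 2) F x := by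
  have h := Algebra.trace_eq_of_algEquiv (FiniteField.frobeniusAlgEquivOfAlgebraic (ZMod 2) F) x
  simpa using h

theorem exists_sq_eq (x : F) : ∃ y : F, y ^ 2 = x := by
  have := charP_two_of_algebra_zmod_two F
  obtain ⟨y, hy⟩ := (bijective_frobenius F 2).2 x
  exact ⟨y, hy⟩

theorem sq_injective_zmod_two_algebra {x y : F} (h : x ^ 2 = y ^ 2) : x = y := by
  have := charP_two_of_algebra_zmod_two F
  exact (bijective_frobenius F 2).1 h

theorem trace_sq_add_self (x : F) : Algebra.trace (ZMod 2) F (x ^ 2 + x) = 0 := by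
  rw [map_add, trace_sq]; exact CharTwo.add_self_eq_zero _

theorem eq_zero_of_trace_mul_eq_zero {x : F}
    (h : ∀ y, Algebra.trace (ZMod 2) F (x * y) = 0) : x = 0 :=
  (traceForm_nondegenerate (ZMod 2) F).1 x h

theorem exists_trace_eq_one (F : Type*) [Field F] [Algebra (ZMod 2) F] [Finite F] :
    ∃ x : F, Algebra.trace (ZMod 2) F x = 1 :=
  Algebra.trace_surjective (ZMod 2) F 1

/-- The additive form of Hilbert 90. -/
theorem exists_sq_add_self_of_trace_eq_zero {x : F} (hx : Algebra.trace (ZMod 2) F x = 0) :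
    ∃ b : F, b ^ 2 + b = x := by
  have := charP_two_of_algebra_zmod_two F
  let P : F →ₗ[ZMod 2] F :=
    (FiniteField.frobeniusAlgHom (ZMod 2) F).toLinearMap + LinearMap.id
  have hP : ∀ b, P b = b ^ 2 + b := fun b => by simp [P]
  have hle : LinearMap.range P ≤ LinearMap.ker (Algebra.trace (ZMod 2) F) := by
    rintro _ ⟨b, rfl⟩
    rw [LinearMap.mem_ker, hP, trace_sq_add_self]
  have hker : LinearMap.ker P ≤ Submodule.span (ZMod 2) {1} := by
    intro b hb
    rw [LinearMap.mem_ker, hP] at hb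
    have : b * (b + 1) = 0 := by linear_combination hb
    rcases mul_eq_zero.1 this with h | h
    · rw [h]; exact Submodule.zero_mem _
    · rw [eq_of_add_eq_zero_zmod_two_algebra h]; exact Submodule.mem_span_singleton_self 1
  have h1 := LinearMap.finrank_range_add_finrank_ker P
  have h2 := LinearMap.finrank_range_add_finrank_ker (Algebra.trace (ZMod 2) F)
  have h3 : Module.finrank (ZMod 2) (LinearMap.ker P) ≤ 1 :=
    (Submodule.finrank_mono hker).trans (finrank_span_singleton (one_ne_zero)).le
  rw [LinearMap.range_eq_top.2 (Algebra.trace_surjective (ZMod 2) F), finrank_top,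
    Module.finrank_self] at h2
  have h4 : LinearMap.range P = LinearMap.ker (Algebra.trace (ZMod 2) F) :=
    Submodule.eq_of_le_of_finrank_le hle (by omega)
  have : x ∈ LinearMap.range P := by rw [h4]; exact hx
  obtain ⟨b, hb⟩ := this
  exact ⟨b, by rw [← hP, hb]⟩

open Classical in
/-- The quadratic form on the trace-zero hyperplane with `b ^ 2 + b ↦ Tr (b + b ^ 3)`. -/
noncomputable def artinSchreierForm (x : F) : ZMod 2 :=
  if h : ∃ b : F, b ^ 2 + b = x then Algebra.trace (ZMod 2) F (h.choose + h.choose ^ 3) else 0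

/-- Independence of the chosen root: replacing b by b + 1 changes b + b³ by b² + b, which has trace
zero. -/
theorem artinSchreierForm_sq_add_self (b : F) :
    artinSchreierForm (b ^ 2 + b) = Algebra.trace (ZMod 2) F (b + b ^ 3) := by
  have h : ∃ c : F, c ^ 2 + c = b ^ 2 + b := ⟨b, rfl⟩
  rw [artinSchreierForm, dif_pos h]
  generalize h.choose_spec = hc
  generalize h.choose = c at hc
  have h2 := two_eq_zero_of_algebra_zmod_two F
  have : (c + b) * (c + b + 1) = 0 := by linear_combination hc + (b * c + b ^ 2 + b) * h2
  rcases mul_eq_zero.1 this with h | h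
  · rw [eq_of_add_eq_zero_zmod_two_algebra h]
  · have : c = b + 1 := by linear_combination h - (b + 1) * h2
    rw [this, show b + 1 + (b + 1) ^ 3 = (b + b ^ 3) + (b ^ 2 + b) from by
      linear_combination (1 + b + b ^ 2) * h2, map_add _ (b + b ^ 3), trace_sq_add_self, add_zero]

/-- The cross term of Tr(b + b³) is Tr(b²c + bc²), and b²c + bc² differs from (b² + b)(c² + c) by
(bc)² + bc. -/
theorem artinSchreierForm_add {x y : F} (hx : Algebra.trace (ZMod 2) F x = 0)
    (hy : Algebra.trace (ZMod 2) F y = 0) :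
    artinSchreierForm (x + y) =
      artinSchreierForm x + artinSchreierForm y + Algebra.trace (ZMod 2) F (x * y) := by
  obtain ⟨b, rfl⟩ := exists_sq_add_self_of_trace_eq_zero hx
  obtain ⟨c, rfl⟩ := exists_sq_add_self_of_trace_eq_zero hy
  have h2 := two_eq_zero_of_algebra_zmod_two F
  rw [show b ^ 2 + b + (c ^ 2 + c) = (b + c) ^ 2 + (b + c) from by linear_combination -b * c * h2,
    artinSchreierForm_sq_add_self, artinSchreierForm_sq_add_self, artinSchreierForm_sq_add_self,
    ← map_add,
    show (b ^ 2 + b) * (c ^ 2 + c) = ((b * c) ^ 2 + b * c) + (b ^ 2 * c + b * c ^ 2) by ring,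
    map_add _ ((b * c) ^ 2 + b * c), trace_sq_add_self, zero_add, ← map_add]
  congr 1
  linear_combination (b ^ 2 * c + b * c ^ 2) * h2

/-- The necessary condition modulo `16` for an element to be a zero of the Kloosterman sum. -/
def IsKloostermanNull (x : F) : Prop :=
  Algebra.trace (ZMod 2) F x = 0 ∧ artinSchreierForm x = 0

theorem isKloostermanNull_sq_add_self {b : F} (h : Algebra.trace (ZMod 2) F (b + b ^ 3) = 0) :
    IsKloostermanNull (b ^ 2 + b) :=
  ⟨trace_sq_add_self b, by rw [artinSchreierForm_sq_add_self, h]⟩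

theorem isKloostermanNull_zero : IsKloostermanNull (0 : F) := by
  have := isKloostermanNull_sq_add_self (b := (0 : F)) (by simp)
  simpa using this

theorem IsKloostermanNull.sq {x : F} (h : IsKloostermanNull x) : IsKloostermanNull (x ^ 2) := by
  obtain ⟨b, rfl⟩ := exists_sq_add_self_of_trace_eq_zero h.1
  have h2 := two_eq_zero_of_algebra_zmod_two F
  have hb := h.2
  rw [artinSchreierForm_sq_add_self] at hb
  rw [show (b ^ 2 + b) ^ 2 = (b ^ 2) ^ 2 + b ^ 2 by linear_combination b ^ 3 * h2]
  refine isKloostermanNull_sq_add_self ?_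
  rw [show b ^ 2 + (b ^ 2) ^ 3 = (b + b ^ 3) ^ 2 by linear_combination -b ^ 4 * h2, trace_sq, hb]

end TraceBasics

/-! ### Vanishing Kloosterman sums, by counting orbits of involutions. -/

section Counting

theorem eq_or_eq_div_of_add_div_eq {F : Type*} [Field F] {c y z : F} (hy : y ≠ 0) (hz : z ≠ 0)
    (h : z + c / z = y + c / y) : z = y ∨ z = c / y := by
  have : (z - y) * (z - c / y) = 0 := by
    field_simp at h ⊢
    linear_combination h
  rcases mul_eq_zero.1 this with h | h
  · exact Or.inl (sub_eq_zero.1 h)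
  · exact Or.inr (sub_eq_zero.1 h)

variable {F : Type*} [Field F] [Algebra (ZMod 2) F] [Finite F]

/-- The fibres of y ↦ y + c/y are the orbits of y ↦ c/y, whose only fixed point d is excluded. -/
theorem card_eq_two_mul_card_image_add_div [DecidableEq F] {c d : F} (hd : d ^ 2 = c)
    (X : Finset F) (h0 : ∀ y ∈ X, y ≠ 0) (h1 : ∀ y ∈ X, y ≠ d) (h2 : ∀ y ∈ X, c / y ∈ X) :
    X.card = 2 * (X.image fun y => y + c / y).card := by
  rw [Finset.card_eq_sum_card_image (fun y => y + c / y) X, mul_comm, ← smul_eq_mul]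
  refine Finset.sum_const_nat (m := 2) ?_
  intro u hu
  obtain ⟨y, hy, rfl⟩ := Finset.mem_image.1 hu
  have hc : c ≠ 0 := fun hc => h0 _ (h2 y hy) (by rw [hc, zero_div])
  have hne : y ≠ c / y := by
    intro h
    rw [eq_div_iff (h0 y hy), ← sq, ← hd] at h
    exact h1 y hy (sq_injective_zmod_two_algebra h)
  rw [← Finset.card_pair hne]
  congr 1
  ext z
  simp only [Finset.mem_filter, Finset.mem_insert, Finset.mem_singleton]
  constructor
  · rintro ⟨hz, h⟩
    exact eq_or_eq_div_of_add_div_eq (h0 y hy) (h0 z hz) h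
  · rintro (rfl | rfl)
    · exact ⟨hy, rfl⟩
    · refine ⟨h2 y hy, ?_⟩
      have := h0 y hy
      field_simp
      ring

theorem mem_of_odd_card_of_forall_div_mem {c d : F} (hd : d ^ 2 = c) (X : Finset F)
    (h0 : ∀ y ∈ X, y ≠ 0) (h2 : ∀ y ∈ X, c / y ∈ X) (hodd : Odd X.card) : d ∈ X := by
  by_contra hdX
  have hs : ∑ _y ∈ X, (1 : ZMod 2) = 0 := by
    refine Finset.sum_involution (fun y _ => c / y) (fun _ _ => rfl) ?_ (fun y hy => h2 y hy) ?_
    · intro y hy _ h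
      rw [div_eq_iff (h0 y hy), ← sq, ← hd] at h
      rw [← sq_injective_zmod_two_algebra h] at hy
      exact hdX hy
    · intro y hy
      have hc : c ≠ 0 := fun hc => h0 _ (h2 y hy) (by rw [hc, zero_div])
      have := h0 y hy
      field_simp
  rw [Finset.sum_const, nsmul_eq_mul, mul_one, ZMod.natCast_eq_zero_iff] at hs
  exact (Nat.not_even_iff_odd.2 hodd) (even_iff_two_dvd.2 hs)

/-- Putting y = uv turns the equation into v² + v = (d/u)². -/
theorem exists_add_div_eq_iff {d u : F} (hd : d ≠ 0) (hu : u ≠ 0) :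
    (∃ y, y ≠ 0 ∧ y + d ^ 2 / y = u) ↔ Algebra.trace (ZMod 2) F (d / u) = 0 := by
  have h2 := two_eq_zero_of_algebra_zmod_two F
  rw [← trace_sq]
  constructor
  · rintro ⟨y, hy, h⟩
    have : (d / u) ^ 2 = (y / u) ^ 2 + y / u := by
      field_simp at h ⊢
      linear_combination h - y ^ 2 * h2
    rw [this, trace_sq_add_self]
  · intro h
    obtain ⟨v, hv⟩ := exists_sq_add_self_of_trace_eq_zero h
    have hv0 : v ≠ 0 := by
      rintro rfl
      have : (d / u) ^ 2 ≠ 0 := pow_ne_zero _ (div_ne_zero hd hu)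
      exact this (by rw [← hv]; ring)
    refine ⟨u * v, mul_ne_zero hu hv0, ?_⟩
    field_simp at hv ⊢
    linear_combination -hv + u ^ 2 * v ^ 2 * h2

/-- If exactly half of the values `Tr (x⁻¹ + a x)` vanish, that is, if the Kloosterman sum of `a`
is zero, then `a` satisfies the conditions modulo `16`. -/
theorem isKloostermanNull_of_card [Fintype F] [DecidableEq F] {a : F} (ha : a ≠ 0)
    {m : ℕ} (hm : (Finset.univ.filter fun x : F =>
      Algebra.trace (ZMod 2) F (x⁻¹ + a * x) = 0).card = 8 * m) : IsKloostermanNull a := by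
  have h2 := two_eq_zero_of_algebra_zmod_two F
  obtain ⟨s, hs⟩ := exists_sq_eq a
  obtain ⟨t, ht⟩ := exists_sq_eq s
  obtain ⟨r, hr⟩ := exists_sq_eq t
  have hs0 : s ≠ 0 := by rintro rfl; exact ha (by rw [← hs]; ring)
  have ht0 : t ≠ 0 := by rintro rfl; exact hs0 (by rw [← ht]; ring)
  have hr0 : r ≠ 0 := by rintro rfl; exact ht0 (by rw [← hr]; ring)
  have hdd : ∀ {c y : F}, c ≠ 0 → y ≠ 0 → c / (c / y) = y := fun hc hy => by field_simp
  -- Two-step descent u = y + a/y, w = u + s/u, with sizes 8m − 1, 4m − 1, 2m − 1. In `S2`, w b² is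
  -- a preimage of w, and the other root b + 1 gives the other preimage.
  set S0 : Finset F := Finset.univ.filter fun y : F =>
    y ≠ 0 ∧ Algebra.trace (ZMod 2) F (y + a / y) = 0 with hS0
  set S1 : Finset F := Finset.univ.filter fun u : F =>
    u ≠ 0 ∧ Algebra.trace (ZMod 2) F u = 0 ∧ Algebra.trace (ZMod 2) F (s / u) = 0 with hS1
  set S2 : Finset F := Finset.univ.filter fun w : F =>
    w ≠ 0 ∧ Algebra.trace (ZMod 2) F w = 0 ∧
      ∃ b, b ^ 2 + b = t / w ∧ Algebra.trace (ZMod 2) F (w * b ^ 2) = 0 with hS2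
  -- The extra 1 is x = 0; nonzero x correspond to y = ax.
  have hc0 : S0.card + 1 = 8 * m := by
    rw [← hm, ← Finset.card_erase_add_one (a := (0 : F)) (s := Finset.univ.filter fun x : F =>
      Algebra.trace (ZMod 2) F (x⁻¹ + a * x) = 0) (by simp)]
    congr 1
    refine Finset.card_bij (fun y _ => y / a) ?_ ?_ ?_
    · intro y hy
      simp only [hS0, Finset.mem_filter, Finset.mem_univ, true_and] at hy
      simp only [Finset.mem_erase, Finset.mem_filter, Finset.mem_univ, true_and]
      refine ⟨div_ne_zero hy.1 ha, ?_⟩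
      rw [← hy.2, inv_div, mul_div_cancel₀ _ ha, add_comm]
    · intro y _ z _ h
      exact (div_left_inj' ha).1 h
    · intro x hx
      simp only [Finset.mem_erase, Finset.mem_filter, Finset.mem_univ, true_and] at hx
      refine ⟨a * x, ?_, by field_simp⟩
      simp only [hS0, Finset.mem_filter, Finset.mem_univ, true_and]
      refine ⟨mul_ne_zero ha hx.1, ?_⟩
      rw [← hx.2, add_comm]
      congr 2
      have := hx.1
      field_simp
  have hsS0 : s ∈ S0 := by
    simp only [hS0, Finset.mem_filter, Finset.mem_univ, true_and]
    refine ⟨hs0, ?_⟩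
    rw [← hs, sq, mul_div_cancel_right₀ _ hs0, add_self_zmod_two_algebra, map_zero]
  have hc1 : S0.card = 2 * S1.card + 1 := by
    rw [← Finset.card_erase_add_one hsS0, card_eq_two_mul_card_image_add_div hs]
    · congr 3
      ext u
      simp only [hS0, hS1, Finset.mem_image, Finset.mem_erase, Finset.mem_filter, Finset.mem_univ,
        true_and]
      constructor
      · rintro ⟨y, ⟨hys, hy0, hy⟩, rfl⟩
        have hu : y + a / y ≠ 0 := by
          intro h
          have := eq_of_add_eq_zero_zmod_two_algebra h
          rw [eq_div_iff hy0, ← sq, ← hs] at this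
          exact hys (sq_injective_zmod_two_algebra this)
        refine ⟨hu, hy, (exists_add_div_eq_iff hs0 hu).1 ⟨y, hy0, by rw [hs]⟩⟩
      · rintro ⟨hu, hu1, hu2⟩
        obtain ⟨y, hy, rfl⟩ := (exists_add_div_eq_iff hs0 hu).2 hu2
        rw [hs] at hu hu1 ⊢
        refine ⟨y, ⟨?_, hy, hu1⟩, rfl⟩
        rintro rfl
        apply hu
        rw [← hs, sq, mul_div_cancel_right₀ _ hs0, add_self_zmod_two_algebra]
    · intro y hy
      simp only [hS0, Finset.mem_erase, Finset.mem_filter, Finset.mem_univ, true_and] at hy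
      exact hy.2.1
    · intro y hy
      exact (Finset.mem_erase.1 hy).1
    · intro y hy
      simp only [hS0, Finset.mem_erase, Finset.mem_filter, Finset.mem_univ, true_and] at hy ⊢
      refine ⟨?_, div_ne_zero ha hy.2.1, by rw [hdd ha hy.2.1, add_comm]; exact hy.2.2⟩
      intro h
      apply hy.1
      rw [div_eq_iff hy.2.1, ← hs, sq] at h
      exact (mul_left_cancel₀ hs0 h).symm
  -- The set is stable under u ↦ s/u and has odd size, so it contains the fixed point.
  have htS1 : t ∈ S1 := by
    refine mem_of_odd_card_of_forall_div_mem ht S1 ?_ ?_ ?_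
    · intro u hu
      simp only [hS1, Finset.mem_filter, Finset.mem_univ, true_and] at hu
      exact hu.1
    · intro u hu
      simp only [hS1, Finset.mem_filter, Finset.mem_univ, true_and] at hu ⊢
      exact ⟨div_ne_zero hs0 hu.1, hu.2.2, by rw [hdd hs0 hu.1]; exact hu.2.1⟩
    · exact ⟨2 * m - 1, by omega⟩
  have htr : Algebra.trace (ZMod 2) F t = 0 := by
    simp only [hS1, Finset.mem_filter, Finset.mem_univ, true_and] at htS1
    exact htS1.2.1
  have hc2 : S1.card = 2 * S2.card + 1 := by
    rw [← Finset.card_erase_add_one htS1, card_eq_two_mul_card_image_add_div ht]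
    · congr 3
      ext w
      simp only [hS1, hS2, Finset.mem_image, Finset.mem_erase, Finset.mem_filter, Finset.mem_univ,
        true_and]
      constructor
      · rintro ⟨u, ⟨hut, hu0, hu, hsu⟩, rfl⟩
        have hw : u + s / u ≠ 0 := by
          intro h
          have := eq_of_add_eq_zero_zmod_two_algebra h
          rw [eq_div_iff hu0, ← sq, ← ht] at this
          exact hut (sq_injective_zmod_two_algebra this)
        obtain ⟨b, hb⟩ := exists_sq_eq (u / (u + s / u))
        refine ⟨hw, by rw [map_add, hu, hsu, add_zero], b, ?_, ?_⟩
        · apply sq_injective_zmod_two_algebra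
          rw [show (b ^ 2 + b) ^ 2 = (b ^ 2) ^ 2 + b ^ 2 by linear_combination b ^ 3 * h2, hb,
            div_pow t, ht]
          generalize hw' : u + s / u = w at *
          field_simp at hw' ⊢
          linear_combination -hw' + u ^ 2 * h2
        · rw [hb, mul_div_cancel₀ _ hw, hu]
      · rintro ⟨hw, hw1, b, hb, hwb⟩
        have hb0 : b ≠ 0 := by
          rintro rfl
          exact div_ne_zero ht0 hw (by rw [← hb]; ring)
        have key : w * b ^ 2 + s / (w * b ^ 2) = w := by
          rw [← ht, show t = w * (b ^ 2 + b) by rw [hb, mul_div_cancel₀ _ hw]]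
          field_simp
          linear_combination (b ^ 2 + b) * h2
        refine ⟨w * b ^ 2, ⟨?_, mul_ne_zero hw (pow_ne_zero _ hb0), hwb, ?_⟩, key⟩
        · intro h
          apply hw
          rw [← key, h, ← ht, sq, mul_div_cancel_right₀ _ ht0, add_self_zmod_two_algebra]
        · have := congrArg (Algebra.trace (ZMod 2) F) key
          rwa [map_add, hwb, zero_add, hw1] at this
    · intro y hy
      simp only [hS1, Finset.mem_erase, Finset.mem_filter, Finset.mem_univ, true_and] at hy
      exact hy.2.1
    · intro y hy
      exact (Finset.mem_erase.1 hy).1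
    · intro u hu
      simp only [hS1, Finset.mem_erase, Finset.mem_filter, Finset.mem_univ, true_and] at hu ⊢
      refine ⟨?_, div_ne_zero hs0 hu.2.1, hu.2.2.2, by rw [hdd hs0 hu.2.1]; exact hu.2.2.1⟩
      intro h
      apply hu.1
      rw [div_eq_iff hu.2.1, ← ht, sq] at h
      exact (mul_left_cancel₀ ht0 h).symm
  have hrS2 : r ∈ S2 := by
    refine mem_of_odd_card_of_forall_div_mem hr S2 ?_ ?_ ?_
    · intro u hu
      simp only [hS2, Finset.mem_filter, Finset.mem_univ, true_and] at hu
      exact hu.1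
    · intro w hw
      simp only [hS2, Finset.mem_filter, Finset.mem_univ, true_and] at hw ⊢
      obtain ⟨hw0, hw1, b, hb, hwb⟩ := hw
      obtain ⟨c, hc⟩ := exists_sq_add_self_of_trace_eq_zero hw1
      refine ⟨div_ne_zero ht0 hw0, by rw [← hb, trace_sq_add_self], c, ?_, ?_⟩
      · rw [hdd ht0 hw0, hc]
      · rw [← hb]
        rw [← hc] at hwb
        have htt : t = (c ^ 2 + c) * (b ^ 2 + b) := by rw [hb, hc, mul_div_cancel₀ _ hw0]
        -- With w = c² + c and t/w = b² + b, this identity and Tr t = 0 show that w ↦ t/w preserves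
        -- the last condition of `S2`.
        have h3 : (b ^ 2 + b) * c ^ 2 + (c ^ 2 + c) * b ^ 2 + t = (b * c) ^ 2 + b * c := by
          rw [htt]; linear_combination (b ^ 2 * c ^ 2 + b ^ 2 * c + b * c ^ 2) * h2
        have h4 := congrArg (Algebra.trace (ZMod 2) F) h3
        rwa [map_add, map_add, hwb, htr, trace_sq_add_self, add_zero, add_zero] at h4
    · exact ⟨m - 1, by omega⟩
  simp only [hS2, Finset.mem_filter, Finset.mem_univ, true_and] at hrS2
  -- At the fixed point t/r = r, so b² + b = r and Tr(rb²) = Tr(b⁴ + b³) = Tr(b + b³).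
  obtain ⟨-, -, b, hb, hrb⟩ := hrS2
  rw [← hr, sq r, mul_div_cancel_right₀ _ hr0] at hb
  have hk : IsKloostermanNull r := by
    rw [← hb]
    refine isKloostermanNull_sq_add_self ?_
    rw [← hb, show (b ^ 2 + b) * b ^ 2 = (b ^ 2) ^ 2 + b ^ 3 by ring, map_add, trace_sq,
      trace_sq] at hrb
    rwa [map_add]
  rw [← hs, ← ht, ← hr]
  exact hk.sq.sq.sq

end Counting

/-! ### From the permutation property to the structure of the kernels. -/

section Adjoint

variable {F : Type*} [Field F] [Algebra (ZMod 2) F] [Finite F]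

theorem two_mul_card_trace_mul_eq_zero [Fintype F] {b : F} (hb : b ≠ 0) :
    2 * (Finset.univ.filter fun y : F => Algebra.trace (ZMod 2) F (y * b) = 0).card =
      Fintype.card F := by
  obtain ⟨z, hz⟩ := exists_trace_eq_one F
  rw [← Finset.card_univ, ← Finset.card_filter_add_card_filter_not (s := Finset.univ)
    (fun y : F => Algebra.trace (ZMod 2) F (y * b) = 0), two_mul]
  congr 1
  have hzb : Algebra.trace (ZMod 2) F (z / b * b) = 1 := by rw [div_mul_cancel₀ _ hb, hz]
  have h1 : ∀ c : ZMod 2, c = 0 → ¬ (c + 1 = 0) := by decide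
  have h2 : ∀ c : ZMod 2, ¬ c = 0 → c + 1 = 0 := by decide
  refine Finset.card_bij (fun y _ => y + z / b) ?_ ?_ ?_
  · intro y hy
    simp only [Finset.mem_filter, Finset.mem_univ, true_and] at hy ⊢
    rw [add_mul, map_add, hzb]
    exact h1 _ hy
  · intro y _ w _ h
    exact add_right_cancel h
  · intro y hy
    simp only [Finset.mem_filter, Finset.mem_univ, true_and] at hy
    refine ⟨y + z / b, ?_, ?_⟩
    · simp only [Finset.mem_filter, Finset.mem_univ, true_and]
      rw [add_mul, map_add, hzb]
      exact h2 _ hy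
    · rw [add_assoc, add_self_zmod_two_algebra, add_zero]

theorem trace_mul_traceAdjoint (L : F →ₗ[ZMod 2] F) (x y : F) :
    Algebra.trace (ZMod 2) F (traceAdjoint L x * y) = Algebra.trace (ZMod 2) F (L y * x) := by
  rw [trace_traceAdjoint L, mul_comm]

theorem card_trace_adjoint_of_bijective [Fintype F] {L₁ L₂ : F →ₗ[ZMod 2] F}
    (hperm : Function.Bijective (fun x : F => L₁ x⁻¹ + L₂ x)) {b : F} (hb : b ≠ 0) :
    2 * (Finset.univ.filter fun x : F => Algebra.trace (ZMod 2) F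
      (traceAdjoint L₁ b * x⁻¹ + traceAdjoint L₂ b * x) = 0).card = Fintype.card F := by
  rw [← two_mul_card_trace_mul_eq_zero hb]
  congr 1
  have key : ∀ x : F, Algebra.trace (ZMod 2) F
      (traceAdjoint L₁ b * x⁻¹ + traceAdjoint L₂ b * x) =
      Algebra.trace (ZMod 2) F ((L₁ x⁻¹ + L₂ x) * b) := fun x => by
    rw [map_add, trace_mul_traceAdjoint, trace_mul_traceAdjoint, ← map_add, add_mul]
  refine Finset.card_bij (fun x _ => L₁ x⁻¹ + L₂ x) ?_ ?_ ?_
  · intro x hx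
    simp only [Finset.mem_filter, Finset.mem_univ, true_and] at hx ⊢
    rwa [← key]
  · intro x _ y _ h
    exact hperm.1 h
  · intro y hy
    simp only [Finset.mem_filter, Finset.mem_univ, true_and] at hy
    obtain ⟨x, rfl⟩ := hperm.2 y
    exact ⟨x, by simpa [key] using hy, rfl⟩

theorem eq_zero_of_traceAdjoint_eq_zero {L₁ L₂ : F →ₗ[ZMod 2] F}
    (hperm : Function.Bijective (fun x : F => L₁ x⁻¹ + L₂ x)) {b : F}
    (h1 : traceAdjoint L₁ b = 0) (h2 : traceAdjoint L₂ b = 0) : b = 0 := by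
  by_contra hb
  have := Fintype.ofFinite F
  have h := card_trace_adjoint_of_bijective hperm hb
  simp only [h1, h2, zero_mul, add_zero, map_zero, Finset.filter_true, Finset.card_univ] at h
  have := Fintype.card_pos (α := F)
  omega

/-- Scaling x by the first factor turns a balanced component into a vanishing Kloosterman sum; n ≥ 4
makes 2ⁿ⁻¹ a multiple of 8. -/
theorem isKloostermanNull_of_bijective {n : ℕ} (hn : 4 ≤ n) (hF : Nat.card F = 2 ^ n)
    {L₁ L₂ : F →ₗ[ZMod 2] F}
    (hperm : Function.Bijective (fun x : F => L₁ x⁻¹ + L₂ x)) (b : F) :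
    IsKloostermanNull (traceAdjoint L₁ b * traceAdjoint L₂ b) := by
  classical
  have := Fintype.ofFinite F
  by_cases h1 : traceAdjoint L₁ b = 0
  · rw [h1, zero_mul]; exact isKloostermanNull_zero
  by_cases h2 : traceAdjoint L₂ b = 0
  · rw [h2, mul_zero]; exact isKloostermanNull_zero
  have hb : b ≠ 0 := by rintro rfl; exact h1 (map_zero _)
  have h := card_trace_adjoint_of_bijective hperm hb
  rw [← Nat.card_eq_fintype_card, hF] at h
  refine isKloostermanNull_of_card (mul_ne_zero h1 h2) (m := 2 ^ (n - 4)) ?_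
  have hpow : 2 ^ n = 16 * 2 ^ (n - 4) := by
    rw [show (16 : ℕ) = 2 ^ 4 by norm_num, ← pow_add]; congr 1; omega
  rw [show 8 * 2 ^ (n - 4) = 2 ^ n / 2 by omega, ← h, Nat.mul_div_cancel_left _ two_pos]
  generalize traceAdjoint L₁ b = u at *
  generalize traceAdjoint L₂ b = v at *
  refine Finset.card_bij (fun x _ => u * x) ?_ ?_ ?_
  · intro x hx
    simp only [Finset.mem_filter, Finset.mem_univ, true_and] at hx ⊢
    rw [← hx, mul_inv, mul_inv_cancel_left₀ h1]
    congr 2; ring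
  · intro x _ y _ h
    exact mul_left_cancel₀ h1 h
  · intro x hx
    simp only [Finset.mem_filter, Finset.mem_univ, true_and] at hx
    refine ⟨x / u, ?_, mul_div_cancel₀ _ h1⟩
    simp only [Finset.mem_filter, Finset.mem_univ, true_and]
    rw [← hx, inv_div, div_eq_mul_inv]
    congr 2
    field_simp

theorem mem_ker_iff_trace_mul_traceAdjoint (L : F →ₗ[ZMod 2] F) (x : F) :
    x ∈ LinearMap.ker L ↔ ∀ c, Algebra.trace (ZMod 2) F (traceAdjoint L c * x) = 0 := by
  rw [LinearMap.mem_ker]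
  constructor
  · intro h c
    rw [trace_mul_traceAdjoint, h, zero_mul, map_zero]
  · intro h
    exact eq_zero_of_trace_mul_eq_zero fun c => by rw [← trace_mul_traceAdjoint, h]

/-- The kernel of the adjoint is the orthogonal complement of the range. -/
theorem finrank_ker_traceAdjoint (L : F →ₗ[ZMod 2] F) :
    Module.finrank (ZMod 2) (LinearMap.ker (traceAdjoint L)) =
      Module.finrank (ZMod 2) (LinearMap.ker L) := by
  have hB := traceForm_nondegenerate (ZMod 2) F
  have h1 := LinearMap.BilinForm.finrank_orthogonal hB (LinearMap.range L)
  have h2 : (Algebra.traceForm (ZMod 2) F).orthogonal (LinearMap.range L) =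
      LinearMap.ker (traceAdjoint L) := by
    ext x
    rw [LinearMap.BilinForm.mem_orthogonal_iff, LinearMap.mem_ker]
    constructor
    · intro h
      refine eq_zero_of_trace_mul_eq_zero fun y => ?_
      rw [trace_mul_traceAdjoint]
      exact h (L y) ⟨y, rfl⟩
    · rintro h _ ⟨y, rfl⟩
      change Algebra.trace (ZMod 2) F (L y * x) = 0
      rw [← trace_mul_traceAdjoint, h, zero_mul, map_zero]
  have h3 := LinearMap.finrank_range_add_finrank_ker L
  rw [h2] at h1
  omega

variable {L₁ L₂ : F →ₗ[ZMod 2] F}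

/-- Moving c by b ∈ ker L₁* changes the product by L₁*(c)L₂*(b), which must have trace zero; so
L₂*(b) is orthogonal to im L₁*. Dimensions agree because L₂* is injective on ker L₁*. -/
theorem ker_eq_map_traceAdjoint_of_isKloostermanNull
    (h0 : ∀ b, traceAdjoint L₁ b = 0 → traceAdjoint L₂ b = 0 → b = 0)
    (hK : ∀ b, IsKloostermanNull (traceAdjoint L₁ b * traceAdjoint L₂ b)) :
    LinearMap.ker L₁ = Submodule.map (traceAdjoint L₂) (LinearMap.ker (traceAdjoint L₁)) := by
  symm
  apply Submodule.eq_of_le_of_finrank_le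
  · rintro _ ⟨b, hb, rfl⟩
    have hb : traceAdjoint L₁ b = 0 := hb
    rw [mem_ker_iff_trace_mul_traceAdjoint]
    intro c
    have h1 := (hK (c + b)).1
    rwa [map_add, map_add, hb, add_zero, mul_add, map_add, (hK c).1, zero_add] at h1
  · rw [← finrank_ker_traceAdjoint L₁]
    have hinj : Function.Injective
        ((traceAdjoint L₂).domRestrict (LinearMap.ker (traceAdjoint L₁))) := by
      rw [← LinearMap.ker_eq_bot, LinearMap.ker_eq_bot']
      rintro ⟨b, hb⟩ h
      exact Subtype.ext (h0 b hb h)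
    rw [← LinearMap.range_domRestrict, LinearMap.finrank_range_of_inj hinj]

/-- With x = L₂*(b), y = L₂*(d), comparing Q at c, c + b, c + d, c + b + d leaves the polar term
Tr(L₁*(c)²xy) = Tr(L₁*(c)z) = 0. -/
theorem mem_ker_of_sq_eq_mul_of_isKloostermanNull
    (hV : LinearMap.ker L₁ = Submodule.map (traceAdjoint L₂) (LinearMap.ker (traceAdjoint L₁)))
    (hK : ∀ b, IsKloostermanNull (traceAdjoint L₁ b * traceAdjoint L₂ b))
    {x y z : F} (hx : x ∈ LinearMap.ker L₁) (hy : y ∈ LinearMap.ker L₁) (hz : z ^ 2 = x * y) :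
    z ∈ LinearMap.ker L₁ := by
  have hx' := (mem_ker_iff_trace_mul_traceAdjoint L₁ x).1 hx
  have hy' := (mem_ker_iff_trace_mul_traceAdjoint L₁ y).1 hy
  rw [mem_ker_iff_trace_mul_traceAdjoint]
  intro c
  rw [hV] at hx hy
  obtain ⟨b, hb, rfl⟩ := hx
  obtain ⟨d, hd, rfl⟩ := hy
  have hb : traceAdjoint L₁ b = 0 := hb
  have hd : traceAdjoint L₁ d = 0 := hd
  rw [← trace_sq, mul_pow, hz]
  have e0 := (hK c)
  have e1 := (hK (c + b)).2
  have e2 := (hK (c + d)).2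
  have e3 := (hK (c + b + d)).2
  simp only [map_add, hb, hd, add_zero, mul_add] at e1 e2 e3
  specialize hx' c
  specialize hy' c
  set p := traceAdjoint L₁ c * traceAdjoint L₂ b
  set r := traceAdjoint L₁ c * traceAdjoint L₂ d
  rw [artinSchreierForm_add e0.1 hx', e0.2, zero_add] at e1
  rw [artinSchreierForm_add e0.1 hy', e0.2, zero_add] at e2
  rw [add_assoc, artinSchreierForm_add e0.1 (by rw [map_add, hx', hy', add_zero]),
    artinSchreierForm_add hx' hy', e0.2, zero_add, mul_add, map_add] at e3
  rw [show traceAdjoint L₁ c ^ 2 * (traceAdjoint L₂ b * traceAdjoint L₂ d) = p * r by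
    simp only [p, r]; ring]
  linear_combination e3 - e1 - e2

end Adjoint

/-! ### Subgroups closed under √(xy). -/

section SubfieldTranslate

variable {F : Type*} [Field F] [Algebra (ZMod 2) F] [Finite F]

theorem exists_eq_pow_of_natCard_subfield {F : Type*} [Field F] [Finite F] {n : ℕ} (hF : Nat.card F = 2 ^ n) (K : Subfield F) :
    ∃ k, k ∣ n ∧ Nat.card K = 2 ^ k := by
  have h : Nat.card F = Nat.card K ^ Module.finrank K F := Module.natCard_eq_pow_finrank
  have hd : Module.finrank K F ≠ 0 := Module.finrank_pos.ne'
  obtain ⟨k, -, hk⟩ := (Nat.dvd_prime_pow Nat.prime_two).1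
    ((dvd_pow_self (Nat.card K) hd).trans (dvd_of_eq (h.symm.trans hF)))
  refine ⟨k, ?_, hk⟩
  rw [hF, hk, ← pow_mul] at h
  exact Dvd.intro _ (Nat.pow_right_injective le_rfl h).symm

/-- A nonzero subgroup of a finite field of characteristic `2` that is closed under
`(x, y) ↦ √(x y)` is a translate of a subfield. -/
theorem isSubfieldTranslate_of_sqrt_mul_mem {n : ℕ} (hF : Nat.card F = 2 ^ n)
    (V : Submodule (ZMod 2) F) (hV : V ≠ ⊥)
    (hsq : ∀ x y z, x ∈ V → y ∈ V → z ^ 2 = x * y → z ∈ V) :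
    IsSubfieldTranslate n (V : Set F) := by
  obtain ⟨v, hv, hv0⟩ := Submodule.exists_mem_ne_zero_of_ne_bot hV
  have hroot : ∀ x y z, v * x ∈ V → v * y ∈ V → z ^ 2 = x * y → v * z ∈ V :=
    fun x y z hx hy hz => hsq _ _ _ hx hy (by rw [mul_pow, hz]; ring)
  have h1 : v * 1 ∈ V := by rwa [mul_one]
  -- Square root is an injective self-map of the finite set v⁻¹V, hence surjective, so squaring
  -- preserves the set too.
  have hsquare : ∀ x, v * x ∈ V → v * x ^ 2 ∈ V := by
    choose f hf using exists_sq_eq (F := F)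
    let g : {x : F // v * x ∈ V} → {x : F // v * x ∈ V} :=
      fun x => ⟨f x, hroot _ _ _ x.2 h1 (by rw [hf, mul_one])⟩
    have hg : Function.Injective g := by
      intro x y h
      apply Subtype.ext
      rw [← hf x, ← hf y]
      exact congrArg (· ^ 2) (congrArg Subtype.val h)
    intro x hx
    obtain ⟨y, hy⟩ := (Finite.injective_iff_surjective.1 hg) ⟨x, hx⟩
    have : f y = x := congrArg Subtype.val hy
    rw [← this, hf]
    exact y.2
  have hmul : ∀ x y, v * x ∈ V → v * y ∈ V → v * (x * y) ∈ V := fun x y hx hy =>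
    hroot _ _ _ (hsquare x hx) (hsquare y hy) (by ring)
  have hpow : ∀ (k : ℕ) x, v * x ∈ V → v * x ^ k ∈ V := by
    intro k x hx
    induction k with
    | zero => simpa using hv
    | succ k ih => rw [pow_succ]; exact hmul _ _ ih hx
  let K : Subfield F :=
    { carrier := {x | v * x ∈ V}
      mul_mem' := fun hx hy => hmul _ _ hx hy
      one_mem' := h1
      add_mem' := fun {x y} hx hy => by
        change v * (x + y) ∈ V
        rw [mul_add]; exact V.add_mem hx hy
      zero_mem' := by change v * 0 ∈ V; rw [mul_zero]; exact V.zero_mem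
      neg_mem' := fun {x} hx => by
        change v * (-x) ∈ V
        rw [mul_neg]; exact V.neg_mem hx
      inv_mem' := fun x hx => by
        change v * x⁻¹ ∈ V
        have := Fintype.ofFinite F
        by_cases hx0 : x = 0
        · rw [hx0, inv_zero, mul_zero]; exact V.zero_mem
        · have : x⁻¹ = x ^ (Fintype.card F - 2) := by
            refine (eq_inv_of_mul_eq_one_left ?_).symm
            rw [← pow_succ, show Fintype.card F - 2 + 1 = Fintype.card F - 1 by
              have := Fintype.one_lt_card (α := F); omega,
              FiniteField.pow_card_sub_one_eq_one x hx0]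
          rw [this]
          exact hpow _ _ hx }
  obtain ⟨k, hkn, hk⟩ := exists_eq_pow_of_natCard_subfield hF K
  refine ⟨v, k, K, hv0, hkn, hk, ?_⟩
  ext x
  constructor
  · intro hx
    refine ⟨x / v, ?_, mul_div_cancel₀ _ hv0⟩
    change v * (x / v) ∈ V
    rwa [mul_div_cancel₀ _ hv0]
  · rintro ⟨y, hy, rfl⟩
    exact hy

end SubfieldTranslate

/-! ### Linearized polynomials. -/

section Linearized

variable {F : Type*} [Field F] [Algebra (ZMod 2) F] [Finite F] {n : ℕ}

theorem finrank_eq_of_natCard_eq (hF : Nat.card F = 2 ^ n) : Module.finrank (ZMod 2) F = n := by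
  have h : Nat.card F = Nat.card (ZMod 2) ^ Module.finrank (ZMod 2) F :=
    Module.natCard_eq_pow_finrank
  rw [hF, Nat.card_zmod] at h
  exact (Nat.pow_right_injective le_rfl h).symm

/-- The power `x ↦ x ^ 2 ^ i` of the Frobenius automorphism. -/
noncomputable def frobPow (F : Type*) [Field F] [Algebra (ZMod 2) F] [Finite F] {n : ℕ}
    (i : ZMod n) : F ≃ₐ[ZMod 2] F :=
  FiniteField.frobeniusAlgEquivOfAlgebraic (ZMod 2) F ^ i.val

theorem frobenius_pow_apply (k : ℕ) (x : F) :
    (FiniteField.frobeniusAlgEquivOfAlgebraic (ZMod 2) F ^ k) x = x ^ 2 ^ k := by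
  induction k generalizing x with
  | zero => simp
  | succ k ih =>
    rw [pow_succ, AlgEquiv.mul_apply, ih, pow_succ', pow_mul]
    simp

theorem frobPow_apply (i : ZMod n) (x : F) : frobPow F i x = x ^ 2 ^ i.val :=
  frobenius_pow_apply _ _

theorem trace_frobPow (i : ZMod n) (x : F) :
    Algebra.trace (ZMod 2) F (frobPow F i x) = Algebra.trace (ZMod 2) F x :=
  Algebra.trace_eq_of_algEquiv _ _

theorem frobPow_zero (x : F) : frobPow F (0 : ZMod n) x = x := by
  rw [frobPow, ZMod.val_zero, pow_zero, AlgEquiv.one_apply]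

theorem frobPow_one (hn : 1 < n) (x : F) : frobPow F (1 : ZMod n) x = x ^ 2 := by
  have : Fact (1 < n) := ⟨hn⟩
  rw [frobPow_apply, ZMod.val_one, pow_one]

variable [NeZero n]

theorem frobPow_add (hF : Nat.card F = 2 ^ n) (i j : ZMod n) (x : F) :
    frobPow F (i + j) x = frobPow F i (frobPow F j x) := by
  have h : FiniteField.frobeniusAlgEquivOfAlgebraic (ZMod 2) F ^ n = 1 := by
    rw [← orderOf_dvd_iff_pow_eq_one, FiniteField.orderOf_frobeniusAlgEquivOfAlgebraic,
      finrank_eq_of_natCard_eq hF]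
  rw [frobPow, ZMod.val_add, ← pow_eq_pow_mod _ h, pow_add]
  rfl

theorem frobPow_injective (hF : Nat.card F = 2 ^ n) :
    Function.Injective (frobPow F : ZMod n → F ≃ₐ[ZMod 2] F) := by
  intro i j h
  have ho : orderOf (FiniteField.frobeniusAlgEquivOfAlgebraic (ZMod 2) F) = n := by
    rw [FiniteField.orderOf_frobeniusAlgEquivOfAlgebraic, finrank_eq_of_natCard_eq hF]
  apply ZMod.val_injective n
  refine pow_injOn_Iio_orderOf ?_ ?_ h
  · rw [Set.mem_Iio, ho]; exact ZMod.val_lt i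
  · rw [Set.mem_Iio, ho]; exact ZMod.val_lt j

/-- Dedekind's independence of characters. -/
theorem eq_zero_of_sum_mul_frobPow_eq_zero (hF : Nat.card F = 2 ^ n) {c : ZMod n → F}
    (h : ∀ x, ∑ i, c i * frobPow F i x = 0) (i : ZMod n) : c i = 0 := by
  have hinj : Function.Injective
      (fun i : ZMod n => ((frobPow F i : F →* F))) := by
    intro i j hij
    apply frobPow_injective hF
    ext x
    exact DFunLike.congr_fun hij x
  have hli := (linearIndependent_monoidHom F F).comp _ hinj
  refine Fintype.linearIndependent_iff.1 hli c ?_ i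
  ext x
  simpa using h x

theorem eq_zero_of_sum_sum_mul_frobPow_eq_zero (hF : Nat.card F = 2 ^ n)
    {c : ZMod n → ZMod n → F}
    (h : ∀ x y, ∑ i, ∑ j, c i j * (frobPow F i x * frobPow F j y) = 0) (i j : ZMod n) :
    c i j = 0 := by
  refine eq_zero_of_sum_mul_frobPow_eq_zero hF (c := fun j => c i j) (fun y => ?_) j
  refine eq_zero_of_sum_mul_frobPow_eq_zero hF
    (c := fun i => ∑ j, c i j * frobPow F j y) (fun x => ?_) i
  rw [← h x y]
  refine Finset.sum_congr rfl fun i _ => ?_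
  rw [Finset.sum_mul]
  refine Finset.sum_congr rfl fun j _ => ?_
  ring

/-- Every `𝔽₂`-linear endomorphism is given by a linearized polynomial. -/
theorem exists_eq_sum_mul_frobPow (hF : Nat.card F = 2 ^ n) (M : F →ₗ[ZMod 2] F) :
    ∃ a : ZMod n → F, ∀ x, M x = ∑ i, a i * frobPow F i x := by
  let P : (ZMod n → F) →ₗ[ZMod 2] (F →ₗ[ZMod 2] F) :=
    { toFun := fun a => ∑ i, LinearMap.mulLeft (ZMod 2) (a i) ∘ₗ (frobPow F i).toLinearMap
      map_add' := fun a b => by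
        ext x; simp [add_mul, Finset.sum_add_distrib]
      map_smul' := fun c a => by
        ext x; simp [Finset.smul_sum] }
  have hP : ∀ a x, P a x = ∑ i, a i * frobPow F i x := fun a x => by simp [P]
  have hinj : Function.Injective P := by
    rw [← LinearMap.ker_eq_bot, LinearMap.ker_eq_bot']
    intro a ha
    ext i
    exact eq_zero_of_sum_mul_frobPow_eq_zero hF (fun x => by rw [← hP, ha]; rfl) i
  -- Both spaces have dimension n², so injectivity yields surjectivity.
  have hfr : Module.finrank (ZMod 2) (ZMod n → F) = Module.finrank (ZMod 2) (F →ₗ[ZMod 2] F) := by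
    rw [Module.finrank_linearMap, Module.finrank_pi_fintype, Finset.sum_const, Finset.card_univ,
      ZMod.card, finrank_eq_of_natCard_eq hF, smul_eq_mul]
  obtain ⟨a, ha⟩ := (LinearMap.injective_iff_surjective_of_finrank_eq_finrank hfr).1 hinj M
  exact ⟨a, fun x => by rw [← hP, ha]⟩

end Linearized

/-! ### Polarising the two conditions on bM(b). -/

section ThirdDifference

variable {F : Type*} [Field F] [Algebra (ZMod 2) F] {M : F →ₗ[ZMod 2] F}

theorem trace_mul_comm_of_isKloostermanNull (hM : ∀ b, IsKloostermanNull (b * M b)) (x y : F) :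
    Algebra.trace (ZMod 2) F (x * M y) = Algebra.trace (ZMod 2) F (y * M x) := by
  have h := (hM (x + y)).1
  rw [map_add, show (x + y) * (M x + M y) = x * M x + y * M y + (x * M y + y * M x) by ring,
    map_add, map_add, (hM x).1, (hM y).1, add_zero, zero_add, map_add] at h
  exact CharTwo.add_eq_zero.1 h

theorem trace_mul_add_mul_of_isKloostermanNull (hM : ∀ b, IsKloostermanNull (b * M b)) (x y : F) :
    Algebra.trace (ZMod 2) F (x * M y + y * M x) = 0 := by
  rw [map_add, trace_mul_comm_of_isKloostermanNull hM x y]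
  exact CharTwo.add_self_eq_zero _

variable [Finite F]

theorem artinSchreierForm_mul_add_mul (hM : ∀ b, IsKloostermanNull (b * M b)) (x y : F) :
    artinSchreierForm (x * M y + y * M x) = Algebra.trace (ZMod 2) F
      (x * M x * (y * M y) + (x * M x + y * M y) * (x * M y + y * M x)) := by
  have h := (hM (x + y)).2
  rw [map_add, show (x + y) * (M x + M y) = x * M x + y * M y + (x * M y + y * M x) by ring,
    artinSchreierForm_add (by rw [map_add, (hM x).1, (hM y).1, add_zero])
      (trace_mul_add_mul_of_isKloostermanNull hM x y), artinSchreierForm_add (hM x).1 (hM y).1,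
    (hM x).2, (hM y).2, zero_add, zero_add] at h
  rw [map_add]
  apply CharTwo.add_eq_zero.1
  rw [← h]
  ring

/-- Expand Q((x + y + z)M(x + y + z)) around x + y: the cross terms with z are two polar terms whose
Q-values are already known. -/
theorem trace_third_difference (hM : ∀ b, IsKloostermanNull (b * M b)) (x y z : F) :
    Algebra.trace (ZMod 2) F (x ^ 2 * (M y * M z) + y * z * M x ^ 2 +
      (y ^ 2 * (M x * M z) + x * z * M y ^ 2) + (z ^ 2 * (M x * M y) + x * y * M z ^ 2)) = 0 := by
  have h2 := two_eq_zero_of_algebra_zmod_two F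
  have t1 := trace_mul_add_mul_of_isKloostermanNull hM x z
  have t2 := trace_mul_add_mul_of_isKloostermanNull hM y z
  have t12 : Algebra.trace (ZMod 2) F (x * M z + z * M x + (y * M z + z * M y)) = 0 := by
    rw [map_add, t1, t2, add_zero]
  have h := (hM (x + y + z)).2
  rw [show (x + y + z) * M (x + y + z) =
      (x + y) * M (x + y) + (z * M z + (x * M z + z * M x + (y * M z + z * M y))) by
    simp only [map_add]; ring,
    artinSchreierForm_add (hM _).1 (by rw [map_add, (hM z).1, t12, add_zero]),
    artinSchreierForm_add (hM z).1 t12, artinSchreierForm_add t1 t2,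
    artinSchreierForm_mul_add_mul hM, artinSchreierForm_mul_add_mul hM, (hM _).2, (hM z).2,
    zero_add, zero_add, ← map_add, ← map_add, ← map_add, ← map_add] at h
  rw [← h]
  congr 1
  rw [map_add]
  generalize M x = X
  generalize M y = Y
  generalize M z = Z
  grind

/-- Self-adjointness of M and Tr(w²) = Tr(w) bring the third difference to the form Tr(x · …); the
square roots come from x²M(y)M(z) and yzM(x)². -/
theorem sum_eq_zero_of_isKloostermanNull (hM : ∀ b, IsKloostermanNull (b * M b)) {y z r s : F}
    (hs : s ^ 2 = M y * M z) (hr : r ^ 2 = y * z) :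
    s + M r + (M (y ^ 2 * M z) + z * M y ^ 2) + (M (z ^ 2 * M y) + y * M z ^ 2) = 0 := by
  refine eq_zero_of_trace_mul_eq_zero fun x => ?_
  rw [← trace_third_difference hM x y z, ← hs, ← hr, ← mul_pow, ← mul_pow]
  have e := fun w => trace_mul_comm_of_isKloostermanNull hM x w
  simp only [add_mul, map_add, trace_sq]
  simp only [mul_comm _ x, e]
  ring_nf

end ThirdDifference

/-! ### Self-adjointness in coefficients. -/

section Coefficients

variable {F : Type*} [Field F] [Algebra (ZMod 2) F] [Finite F] {n : ℕ} [NeZero n]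

variable {M : F →ₗ[ZMod 2] F} {a : ZMod n → F}

theorem frobPow_coeff_neg (hF : Nat.card F = 2 ^ n) (hM : ∀ b, IsKloostermanNull (b * M b))
    (ha : ∀ x, M x = ∑ i, a i * frobPow F i x) (i : ZMod n) : frobPow F i (a (-i)) = a i := by
  have h : ∀ x, ∑ i, (frobPow F i (a (-i)) - a i) * frobPow F i x = 0 := by
    intro x
    simp only [sub_mul, Finset.sum_sub_distrib]
    rw [← ha, sub_eq_zero]
    symm
    rw [← sub_eq_zero]
    refine eq_zero_of_trace_mul_eq_zero fun y => ?_
    rw [sub_mul, map_sub, sub_eq_zero, mul_comm, trace_mul_comm_of_isKloostermanNull hM, ha,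
      Finset.mul_sum, Finset.sum_mul, map_sum, map_sum, ← Equiv.sum_comp (Equiv.neg (ZMod n))]
    refine Finset.sum_congr rfl fun i _ => ?_
    rw [← trace_frobPow i]
    congr 1
    rw [Equiv.neg_apply, map_mul, map_mul, ← frobPow_add hF, add_neg_cancel, frobPow_zero]
    ring
  exact sub_eq_zero.1 (eq_zero_of_sum_mul_frobPow_eq_zero hF h i)

end Coefficients

/-! ### Coefficient relations from the third difference. -/

section Relation

variable {F : Type*} [Field F] [Algebra (ZMod 2) F] [Finite F] {n : ℕ} [NeZero n]

/-- The `𝔽₂`-bilinear map with coefficients `c` in the basis of products of Frobenius powers. -/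
noncomputable def frobBilin (c : ZMod n → ZMod n → F) (y z : F) : F :=
  ∑ p, ∑ q, c p q * (frobPow F p y * frobPow F q z)

theorem frobBilin_swap (c : ZMod n → ZMod n → F) (y z : F) :
    frobBilin c z y = frobBilin (fun p q => c q p) y z := by
  rw [frobBilin, frobBilin, Finset.sum_comm]
  simp only [mul_comm (frobPow F _ z)]

theorem frobBilin_add (c d : ZMod n → ZMod n → F) (y z : F) :
    frobBilin c y z + frobBilin d y z = frobBilin (fun p q => c p q + d p q) y z := by
  simp only [frobBilin, add_mul, Finset.sum_add_distrib]

variable {M : F →ₗ[ZMod 2] F} {a : ZMod n → F}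

theorem apply_eq_sum_shift (ha : ∀ x, M x = ∑ i, a i * frobPow F i x) (k : ZMod n) (x : F) :
    M x = ∑ i, a (i + k) * frobPow F (i + k) x := by
  rw [ha, ← Equiv.sum_comp (Equiv.addRight k)]
  rfl

theorem frobPow_neg_one_mul_eq_frobBilin (hF : Nat.card F = 2 ^ n)
    (ha : ∀ x, M x = ∑ i, a i * frobPow F i x) (y z : F) :
    frobPow F (-1 : ZMod n) (M y * M z) =
      frobBilin (fun p q => frobPow F (-1 : ZMod n) (a (p + 1) * a (q + 1))) y z := by
  rw [apply_eq_sum_shift ha 1 y, apply_eq_sum_shift ha 1 z, Finset.sum_mul_sum, map_sum, frobBilin]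
  refine Finset.sum_congr rfl fun p _ => ?_
  rw [map_sum]
  refine Finset.sum_congr rfl fun q _ => ?_
  have h : ∀ (p : ZMod n) (x : F), frobPow F (-1 : ZMod n) (frobPow F (p + 1) x) = frobPow F p x :=
    fun p x => by rw [← frobPow_add hF]; congr 2; ring
  simp only [map_mul, h]
  ring

theorem apply_frobPow_neg_one_eq_frobBilin (hF : Nat.card F = 2 ^ n)
    (ha : ∀ x, M x = ∑ i, a i * frobPow F i x) (y z : F) :
    M (frobPow F (-1 : ZMod n) (y * z)) =
      frobBilin (fun p q => if p = q then a (p + 1) else 0) y z := by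
  rw [apply_eq_sum_shift ha 1, frobBilin]
  refine Finset.sum_congr rfl fun p _ => ?_
  simp only [ite_mul, zero_mul, Finset.sum_ite_eq, Finset.mem_univ, if_true]
  rw [← frobPow_add hF, add_neg_cancel_right, map_mul]

theorem apply_sq_mul_eq_frobBilin (hn : 1 < n) (hF : Nat.card F = 2 ^ n)
    (ha : ∀ x, M x = ∑ i, a i * frobPow F i x) (y z : F) :
    M (y ^ 2 * M z) =
      frobBilin (fun p q => a (p - 1) * frobPow F (p - 1) (a (q - p + 1))) y z := by
  rw [apply_eq_sum_shift ha (-1) (y ^ 2 * M z), frobBilin]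
  refine Finset.sum_congr rfl fun p _ => ?_
  rw [apply_eq_sum_shift ha (-p + 1) z, ← frobPow_one hn, map_mul, ← frobPow_add hF, map_sum,
    Finset.mul_sum, Finset.mul_sum]
  refine Finset.sum_congr rfl fun q _ => ?_
  rw [map_mul, ← frobPow_add hF, show p + -1 + 1 = p by ring,
    show p + -1 + (q + (-p + 1)) = q by ring, show p + -1 = p - 1 by ring,
    show q + (-p + 1) = q - p + 1 by ring]
  ring

theorem mul_apply_sq_eq_frobBilin (hn : 1 < n) (hF : Nat.card F = 2 ^ n)
    (ha : ∀ x, M x = ∑ i, a i * frobPow F i x) (y z : F) :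
    z * M y ^ 2 =
      frobBilin (fun p q => if q = 0 then frobPow F (1 : ZMod n) (a (p - 1)) else 0) y z := by
  rw [← frobPow_one hn, apply_eq_sum_shift ha (-1) y, frobBilin, map_sum, Finset.mul_sum]
  refine Finset.sum_congr rfl fun p _ => ?_
  simp only [ite_mul, zero_mul, Finset.sum_ite_eq', Finset.mem_univ, if_true]
  rw [map_mul, ← frobPow_add hF, frobPow_zero, show 1 + (p + -1) = p by ring,
    show p + -1 = p - 1 by ring]
  ring

/-- This is the coefficient of y^(2^p) z^(2^q); the term M(√(yz)) contributes only when p = q. -/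
theorem coeff_relation (hn : 1 < n) (hF : Nat.card F = 2 ^ n)
    (hM : ∀ b, IsKloostermanNull (b * M b)) (ha : ∀ x, M x = ∑ i, a i * frobPow F i x)
    {p q : ZMod n} (hpq : p ≠ q) :
    frobPow F (-1 : ZMod n) (a (p + 1) * a (q + 1)) +
      (a (p - 1) * frobPow F (p - 1) (a (q - p + 1)) +
        (if q = 0 then frobPow F (1 : ZMod n) (a (p - 1)) else 0)) +
      (a (q - 1) * frobPow F (q - 1) (a (p - q + 1)) +
        (if p = 0 then frobPow F (1 : ZMod n) (a (q - 1)) else 0)) = 0 := by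
  have hsq : ∀ x : F, frobPow F (-1 : ZMod n) x ^ 2 = x := fun x => by
    rw [← frobPow_one hn, ← frobPow_add hF, add_neg_cancel, frobPow_zero]
  have h := eq_zero_of_sum_sum_mul_frobPow_eq_zero hF (c := fun p q =>
    frobPow F (-1 : ZMod n) (a (p + 1) * a (q + 1)) + (if p = q then a (p + 1) else 0) +
    (a (p - 1) * frobPow F (p - 1) (a (q - p + 1)) +
      (if q = 0 then frobPow F (1 : ZMod n) (a (p - 1)) else 0)) +
    (a (q - 1) * frobPow F (q - 1) (a (p - q + 1)) +
      (if p = 0 then frobPow F (1 : ZMod n) (a (q - 1)) else 0))) (fun y z => by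
      have e := sum_eq_zero_of_isKloostermanNull hM (hsq (M y * M z)) (hsq (y * z))
      rwa [frobPow_neg_one_mul_eq_frobBilin hF ha, apply_frobPow_neg_one_eq_frobBilin hF ha,
        apply_sq_mul_eq_frobBilin hn hF ha, apply_sq_mul_eq_frobBilin hn hF ha,
        mul_apply_sq_eq_frobBilin hn hF ha, mul_apply_sq_eq_frobBilin hn hF ha,
        frobBilin_swap _ y z, frobBilin_swap _ y z, frobBilin_add, frobBilin_add, frobBilin_add,
        frobBilin_add, frobBilin_add] at e) p q
  simpa [hpq] using h

/-- The second elementary symmetric function of the monomials of a linearized polynomial, where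
`ε` chooses one of `(i, j)` and `(j, i)` for all `i ≠ j`. -/
noncomputable def secondSymm (ε : ZMod n → ZMod n → ZMod 2) (a : ZMod n → F) (x : F) : F :=
  ∑ i, ∑ j, ε i j • (a i * frobPow F i x * (a j * frobPow F j x))

theorem frobPow_neg_one_secondSymm (hF : Nat.card F = 2 ^ n) (ε : ZMod n → ZMod n → ZMod 2)
    (a : ZMod n → F) (x : F) :
    frobPow F (-1 : ZMod n) (secondSymm ε a x) =
      frobBilin (fun p q => ε (p + 1) (q + 1) • frobPow F (-1 : ZMod n) (a (p + 1) * a (q + 1)))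
        x x := by
  have h : ∀ (p : ZMod n) (x : F), frobPow F (-1 : ZMod n) (frobPow F (p + 1) x) = frobPow F p x :=
    fun p x => by rw [← frobPow_add hF]; congr 2; ring
  rw [secondSymm, ← Equiv.sum_comp (Equiv.addRight 1), map_sum, frobBilin]
  refine Finset.sum_congr rfl fun p _ => ?_
  rw [← Equiv.sum_comp (Equiv.addRight 1), map_sum]
  refine Finset.sum_congr rfl fun q _ => ?_
  simp only [Equiv.coe_addRight, map_smul, map_mul, h, smul_mul_assoc]
  congr 1
  ring

theorem frobBilin_self_of_symm (c : ZMod n → ZMod n → F) (hc : ∀ p q, p ≠ q → c p q + c q p = 0)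
    (x : F) : frobBilin c x x = ∑ p, c p p * frobPow F p x ^ 2 := by
  have : CharP F 2 := charP_two_of_algebra_zmod_two F
  rw [frobBilin, ← Finset.sum_product', ← Finset.diag_union_offDiag,
    Finset.sum_union (Finset.disjoint_diag_offDiag _), Finset.sum_diag]
  conv_rhs => rw [← add_zero (∑ p, c p p * frobPow F p x ^ 2)]
  congr 1
  · simp only [sq]
  · refine Finset.sum_involution (fun z _ => z.swap) ?_ ?_ ?_ ?_
    · rintro ⟨p, q⟩ h
      have := hc p q (Finset.mem_offDiag.1 h).2.2
      simp only [Prod.swap_prod_mk]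
      linear_combination (frobPow F p x * frobPow F q x) * this
    · rintro ⟨p, q⟩ h _ h'
      exact (Finset.mem_offDiag.1 h).2.2 (congrArg Prod.snd h')
    · rintro ⟨p, q⟩ h
      have := (Finset.mem_offDiag.1 h).2.2
      simp [Ne.symm this]
    · rintro ⟨p, q⟩ _
      rfl

/-- The coefficients of the linear part of the second difference. -/
noncomputable def secondDiffCoeff (a : ZMod n → F) (j : ZMod n) : F :=
  a (j - 2) * frobPow F (j - 2) (a 1) + if j = 1 then frobPow F (1 : ZMod n) (a (-1)) else 0

/-- The left side is a priori quadratic in x. By `coeff_relation` its off-diagonal terms cancel, and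
a diagonal term (x^(2^p))² is additive, contributing at index j = p + 1. -/
theorem secondDiff_eq_sum (hn : 1 < n) (hF : Nat.card F = 2 ^ n)
    (hM : ∀ b, IsKloostermanNull (b * M b)) (ha : ∀ x, M x = ∑ i, a i * frobPow F i x)
    {ε : ZMod n → ZMod n → ZMod 2} (hε0 : ∀ i, ε i i = 0)
    (hε1 : ∀ i j, i ≠ j → ε i j + ε j i = 1) (x : F) :
    M (x ^ 2 * M x) + x * M x ^ 2 + frobPow F (-1 : ZMod n) (secondSymm ε a x) =
      ∑ j, secondDiffCoeff a j * frobPow F j x := by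
  rw [apply_sq_mul_eq_frobBilin hn hF ha, mul_apply_sq_eq_frobBilin hn hF ha,
    frobPow_neg_one_secondSymm hF, frobBilin_add, frobBilin_add, frobBilin_self_of_symm]
  · rw [← Equiv.sum_comp (Equiv.subRight (1 : ZMod n))]
    refine Finset.sum_congr rfl fun j _ => ?_
    simp only [Equiv.subRight_apply, hε0, zero_smul, add_zero, sub_self, zero_add]
    rw [← frobPow_one hn, ← frobPow_add hF, secondDiffCoeff, add_sub_cancel,
      show j - 1 - 1 = j - 2 by ring]
    congr 2
    by_cases hj : j = 1
    · subst hj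
      rw [if_pos (sub_self _), if_pos rfl, show (1 : ZMod n) - 2 = -1 by ring]
    · rw [if_neg hj, if_neg (sub_ne_zero.2 hj)]
  · intro p q hpq
    have e := coeff_relation hn hF hM ha hpq
    rw [mul_comm (a (q + 1)) (a (p + 1))]
    have h := hε1 (p + 1) (q + 1) (fun h => hpq (add_right_cancel h))
    have h' := congrArg (· • frobPow F (-1 : ZMod n) (a (p + 1) * a (q + 1))) h
    simp only [add_smul, one_smul] at h'
    linear_combination h' + e

end Relation

/-! ### The second difference, and vanishing of M. -/

section SecondDifference

variable {F : Type*} [Field F] [Algebra (ZMod 2) F] [Finite F]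

theorem artinSchreierForm_sq {x : F} (hx : Algebra.trace (ZMod 2) F x = 0) :
    artinSchreierForm (x ^ 2) = artinSchreierForm x := by
  have h2 := two_eq_zero_of_algebra_zmod_two F
  obtain ⟨b, rfl⟩ := exists_sq_add_self_of_trace_eq_zero hx
  rw [show (b ^ 2 + b) ^ 2 = (b ^ 2) ^ 2 + b ^ 2 by linear_combination b ^ 3 * h2,
    artinSchreierForm_sq_add_self, artinSchreierForm_sq_add_self, ← trace_sq (b + b ^ 3)]
  congr 1
  linear_combination -b ^ 4 * h2

/-- Induction through w + w^(2^(k+1)) = (w² + w) + (w + w^(2^k))². -/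
theorem artinSchreierForm_add_pow (w : F) (k : ℕ) :
    artinSchreierForm (w + w ^ 2 ^ k) =
      Algebra.trace (ZMod 2) F w + Algebra.trace (ZMod 2) F (w * w ^ 2 ^ k) := by
  have h2 := two_eq_zero_of_algebra_zmod_two F
  have htr : ∀ k : ℕ, Algebra.trace (ZMod 2) F (w + w ^ 2 ^ k) = 0 := fun k => by
    rw [map_add, ← frobenius_pow_apply k, Algebra.trace_eq_of_algEquiv]
    exact CharTwo.add_self_eq_zero _
  induction k with
  | zero =>
    rw [pow_zero, pow_one, add_self_zmod_two_algebra, ← sq, trace_sq, CharTwo.add_self_eq_zero]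
    exact isKloostermanNull_zero.2
  | succ k ih =>
    have h : w ^ 2 ^ (k + 1) = (w ^ 2 ^ k) ^ 2 := by rw [pow_succ, pow_mul]
    rw [h, show w + (w ^ 2 ^ k) ^ 2 = (w ^ 2 + w) + (w + w ^ 2 ^ k) ^ 2 by
        linear_combination -(w ^ 2 + w * w ^ 2 ^ k) * h2,
      artinSchreierForm_add (trace_sq_add_self w) (by rw [trace_sq, htr]),
      artinSchreierForm_sq (htr k), ih, artinSchreierForm_sq_add_self]
    generalize w ^ 2 ^ k = v
    rw [show (w ^ 2 + w) * (w + v) ^ 2 = (w ^ 2) ^ 2 + (w * v) ^ 2 + w ^ 3 + w * v ^ 2 by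
      linear_combination (w ^ 3 * v + w ^ 2 * v) * h2]
    simp only [map_add, trace_sq]
    generalize Algebra.trace (ZMod 2) F w = t1
    generalize Algebra.trace (ZMod 2) F (w ^ 3) = t2
    generalize Algebra.trace (ZMod 2) F (w * v) = t3
    generalize Algebra.trace (ZMod 2) F (w * v ^ 2) = t4
    revert t1 t2 t3 t4
    decide

theorem artinSchreierForm_sum {ι : Type*} [DecidableEq ι] {ε : ι → ι → ZMod 2}
    (hε0 : ∀ i, ε i i = 0) (hε1 : ∀ i j, i ≠ j → ε i j + ε j i = 1) (s : Finset ι) (u : ι → F)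
    (hu : ∀ i, Algebra.trace (ZMod 2) F (u i) = 0) :
    artinSchreierForm (∑ i ∈ s, u i) = ∑ i ∈ s, artinSchreierForm (u i) +
      ∑ i ∈ s, ∑ j ∈ s, ε i j * Algebra.trace (ZMod 2) F (u i * u j) := by
  induction s using Finset.induction_on with
  | empty => simpa using isKloostermanNull_zero.2
  | insert k s hk ih =>
    have hs : Algebra.trace (ZMod 2) F (∑ i ∈ s, u i) = 0 := by
      rw [map_sum]; exact Finset.sum_eq_zero fun i _ => hu i
    have hcross : Algebra.trace (ZMod 2) F (u k * ∑ i ∈ s, u i) =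
        ∑ i ∈ s, ε k i * Algebra.trace (ZMod 2) F (u k * u i) +
          ∑ i ∈ s, ε i k * Algebra.trace (ZMod 2) F (u i * u k) := by
      rw [Finset.mul_sum, map_sum, ← Finset.sum_add_distrib]
      refine Finset.sum_congr rfl fun i hi => ?_
      have h := hε1 k i (by rintro rfl; exact hk hi)
      rw [mul_comm (u i)]
      linear_combination -(Algebra.trace (ZMod 2) F (u k * u i)) * h
    rw [Finset.sum_insert hk, artinSchreierForm_add (hu k) hs, ih, hcross]
    simp only [Finset.sum_insert hk, hε0, Finset.sum_add_distrib]
    ring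

variable {n : ℕ} [NeZero n] {M : F →ₗ[ZMod 2] F} {a : ZMod n → F}

/-- Self-adjointness pairs each monomial uᵢ of xM(y) with a Frobenius conjugate vᵢ in yM(x). So Q is
explicit on every uᵢ + vᵢ, and only the polar terms between different pairs remain. -/
theorem artinSchreierForm_mul_add_mul_eq_secondSymm (hF : Nat.card F = 2 ^ n)
    (hM : ∀ b, IsKloostermanNull (b * M b)) (ha : ∀ x, M x = ∑ i, a i * frobPow F i x)
    {ε : ZMod n → ZMod n → ZMod 2} (hε0 : ∀ i, ε i i = 0)
    (hε1 : ∀ i j, i ≠ j → ε i j + ε j i = 1) (x y : F) :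
    artinSchreierForm (x * M y + y * M x) = Algebra.trace (ZMod 2) F (x * M y) +
      Algebra.trace (ZMod 2) F (x * M y * (y * M x)) +
      Algebra.trace (ZMod 2) F (x ^ 2 * secondSymm ε a y) +
      Algebra.trace (ZMod 2) F (y ^ 2 * secondSymm (fun i j => ε (-i) (-j)) a x) := by
  set u : ZMod n → F := fun i => x * (a i * frobPow F i y) with hu
  set v : ZMod n → F := fun i => y * (a (-i) * frobPow F (-i) x) with hv
  have huv : ∀ i, v i = frobPow F (-i) (u i) := by
    intro i
    have h := frobPow_coeff_neg hF hM ha (-i)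
    rw [neg_neg] at h
    simp only [hu, hv, map_mul, ← frobPow_add hF, neg_add_cancel, frobPow_zero, h]
    ring
  have hxy : x * M y = ∑ i, u i := by rw [ha, Finset.mul_sum]
  have hyx : y * M x = ∑ i, v i := by
    rw [ha, Finset.mul_sum, ← Equiv.sum_comp (Equiv.neg (ZMod n))]; rfl
  have htr : ∀ i, Algebra.trace (ZMod 2) F (u i + v i) = 0 := fun i => by
    rw [map_add, huv, trace_frobPow]; exact CharTwo.add_self_eq_zero _
  have hQ : ∀ i, artinSchreierForm (u i + v i) =
      Algebra.trace (ZMod 2) F (u i) + Algebra.trace (ZMod 2) F (u i * v i) := fun i => by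
    rw [huv, frobPow_apply, artinSchreierForm_add_pow]
  have e1 : Algebra.trace (ZMod 2) F (x ^ 2 * secondSymm ε a y) =
      ∑ i, ∑ j, ε i j * Algebra.trace (ZMod 2) F (u i * u j) := by
    rw [secondSymm, Finset.mul_sum, map_sum]
    refine Finset.sum_congr rfl fun i _ => ?_
    rw [Finset.mul_sum, map_sum]
    refine Finset.sum_congr rfl fun j _ => ?_
    rw [mul_smul_comm, map_smul, smul_eq_mul]
    congr 2
    ring
  have e2 : Algebra.trace (ZMod 2) F (y ^ 2 * secondSymm (fun i j => ε (-i) (-j)) a x) =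
      ∑ i, ∑ j, ε i j * Algebra.trace (ZMod 2) F (v i * v j) := by
    rw [secondSymm, Finset.mul_sum, map_sum, ← Equiv.sum_comp (Equiv.neg (ZMod n))]
    refine Finset.sum_congr rfl fun i _ => ?_
    rw [Finset.mul_sum, map_sum, ← Equiv.sum_comp (Equiv.neg (ZMod n))]
    refine Finset.sum_congr rfl fun j _ => ?_
    simp only [Equiv.neg_apply, neg_neg]
    rw [mul_smul_comm, map_smul, smul_eq_mul]
    congr 2
    ring
  have e3 : Algebra.trace (ZMod 2) F (x * M y * (y * M x)) =
      ∑ i, Algebra.trace (ZMod 2) F (u i * v i) +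
        ∑ i, ∑ j, ε i j * (Algebra.trace (ZMod 2) F (u i * v j) +
          Algebra.trace (ZMod 2) F (u j * v i)) := by
    have hswap : ∑ i, ∑ j, ε i j * Algebra.trace (ZMod 2) F (u j * v i) =
        ∑ i, ∑ j, ε j i * Algebra.trace (ZMod 2) F (u i * v j) := Finset.sum_comm
    simp only [mul_add, Finset.sum_add_distrib]
    rw [hswap, ← Finset.sum_add_distrib, ← Finset.sum_add_distrib, hxy, hyx, Finset.sum_mul_sum,
      map_sum]
    refine Finset.sum_congr rfl fun i _ => ?_
    rw [map_sum, ← Finset.sum_add_distrib, ← Finset.add_sum_erase _ _ (Finset.mem_univ i),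
      ← Finset.add_sum_erase _ (fun j => _ + _) (Finset.mem_univ i)]
    simp only [hε0, zero_mul, zero_add]
    congr 1
    refine Finset.sum_congr rfl fun j hj => ?_
    have h := hε1 i j (Finset.ne_of_mem_erase hj).symm
    linear_combination -(Algebra.trace (ZMod 2) F (u i * v j)) * h
  rw [e1, e2, e3, hxy, hyx, ← Finset.sum_add_distrib, artinSchreierForm_sum hε0 hε1 _ _ htr]
  simp only [hQ, map_sum, Finset.sum_add_distrib, add_mul, mul_add, map_add, mul_comm (v _) (u _)]
  ring

/-- Equates the two evaluations of Q(xM(y) + yM(x)): by polarisation and by monomials. -/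
theorem trace_second_difference (hn : 1 < n) (hF : Nat.card F = 2 ^ n)
    (hM : ∀ b, IsKloostermanNull (b * M b)) (ha : ∀ x, M x = ∑ i, a i * frobPow F i x) (x y : F) :
    Algebra.trace (ZMod 2) F (y * M x + y * ∑ j, secondDiffCoeff a j * frobPow F j x +
      x * ∑ j, secondDiffCoeff a j * frobPow F j y) = 0 := by
  set ε : ZMod n → ZMod n → ZMod 2 := fun i j => if i.val < j.val then 1 else 0 with hε
  have hε0 : ∀ i, ε i i = 0 := fun i => by simp [hε]
  have hε1 : ∀ i j, i ≠ j → ε i j + ε j i = 1 := fun i j hij => by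
    rcases lt_or_gt_of_ne (fun h => hij (ZMod.val_injective n h)) with h | h
    · simp [hε, h, h.not_gt]
    · simp [hε, h, h.not_gt]
  have hsq : ∀ z w : F, Algebra.trace (ZMod 2) F (z ^ 2 * w) =
      Algebra.trace (ZMod 2) F (z * frobPow F (-1 : ZMod n) w) := fun z w => by
    rw [← trace_sq (z * _), mul_pow, ← frobPow_one hn (frobPow F _ w), ← frobPow_add hF,
      add_neg_cancel, frobPow_zero]
  have h := artinSchreierForm_mul_add_mul hM x y
  rw [artinSchreierForm_mul_add_mul_eq_secondSymm hF hM ha hε0 hε1, hsq, hsq,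
    trace_mul_comm_of_isKloostermanNull hM x y] at h
  rw [← secondDiff_eq_sum hn hF hM ha hε0 hε1 y, ← secondDiff_eq_sum hn hF hM ha
    (ε := fun i j => ε (-i) (-j)) (fun i => hε0 _)
    (fun i j hij => hε1 _ _ fun h => hij (neg_injective h)) x]
  have e := fun z w => trace_mul_comm_of_isKloostermanNull hM z w
  simp only [mul_add, map_add, e y (x ^ 2 * M x), e x (y ^ 2 * M y)]
  rw [show (x * M x * (y * M y) + (x * M x + y * M y) * (x * M y + y * M x)) =
    x * M y * (y * M x) + x ^ 2 * M x * M y + y * (x * M x ^ 2) + x * (y * M y ^ 2) +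
      y ^ 2 * M y * M x by ring] at h
  simp only [map_add] at h
  generalize frobPow F (-1 : ZMod n) (secondSymm ε a y) = s1 at *
  generalize frobPow F (-1 : ZMod n) (secondSymm (fun i j => ε (-i) (-j)) a x) = s2 at *
  have two_zero : (2 : ZMod 2) = 0 := rfl
  linear_combination h + (Algebra.trace (ZMod 2) F (x ^ 2 * M x * M y) +
    Algebra.trace (ZMod 2) F (y ^ 2 * M y * M x) + Algebra.trace (ZMod 2) F (y * (x * M x ^ 2)) +
    Algebra.trace (ZMod 2) F (x * (y * M y ^ 2))) * two_zero

theorem secondDiffCoeff_relation (hn : 1 < n) (hF : Nat.card F = 2 ^ n)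
    (hM : ∀ b, IsKloostermanNull (b * M b)) (ha : ∀ x, M x = ∑ i, a i * frobPow F i x)
    (k : ZMod n) :
    a k + secondDiffCoeff a k + frobPow F k (secondDiffCoeff a (-k)) = 0 := by
  refine eq_zero_of_sum_mul_frobPow_eq_zero hF
    (c := fun k => a k + secondDiffCoeff a k + frobPow F k (secondDiffCoeff a (-k)))
    (fun x => ?_) k
  refine eq_zero_of_trace_mul_eq_zero fun y => ?_
  rw [← trace_second_difference hn hF hM ha x y]
  have h : Algebra.trace (ZMod 2) F (x * ∑ j, secondDiffCoeff a j * frobPow F j y) =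
      Algebra.trace (ZMod 2) F
        (y * ∑ j, frobPow F j (secondDiffCoeff a (-j)) * frobPow F j x) := by
    rw [Finset.mul_sum, Finset.mul_sum, map_sum, map_sum,
      ← Equiv.sum_comp (Equiv.neg (ZMod n))]
    refine Finset.sum_congr rfl fun j _ => ?_
    rw [← trace_frobPow j]
    congr 1
    rw [Equiv.neg_apply, map_mul, map_mul, ← frobPow_add hF, add_neg_cancel, frobPow_zero]
    ring
  rw [map_add, h, ← map_add, ha x, ← mul_add, ← mul_add, mul_comm, ← Finset.sum_add_distrib,
    ← Finset.sum_add_distrib]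
  simp only [add_mul]

theorem eq_zero_of_forall_isKloostermanNull (hn : 5 ≤ n) (hF : Nat.card F = 2 ^ n)
    (hM : ∀ b, IsKloostermanNull (b * M b)) : M = 0 := by
  obtain ⟨a, ha⟩ := exists_eq_sum_mul_frobPow (n := n) hF M
  have hn1 : 1 < n := by omega
  have h2 := two_eq_zero_of_algebra_zmod_two F
  have hrel := secondDiffCoeff_relation hn1 hF hM ha
  have hneg := frobPow_coeff_neg hF hM ha
  have hne : ∀ k : ℕ, 0 < k → k < n → (k : ZMod n) ≠ 0 := by
    intro k hk hkn h
    rw [ZMod.natCast_eq_zero_iff] at h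
    exact absurd (Nat.le_of_dvd hk h) (by omega)
  have n2 := hne 2 (by norm_num) (by omega)
  have n4 := hne 4 (by norm_num) (by omega)
  push_cast at n2 n4
  have ha1 : a 1 = 0 := by
    by_contra ha1
    have hfr : ∀ k : ZMod n, frobPow F k (a 1) ≠ 0 := fun k => by simpa using ha1
    -- Relation at k = 1: since a₋₁² = a₁, it reduces to φ(a₋₃)φ⁻²(a₁) = a₁ with φ the Frobenius;
    -- then apply φ².
    have a3 : a 3 = a 1 ^ 3 := by
      have h := hrel 1
      have hm := hneg (-1)
      rw [neg_neg] at hm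
      rw [secondDiffCoeff, secondDiffCoeff, if_pos rfl,
        if_neg (fun h => n2 (by linear_combination -h)), show (1 : ZMod n) - 2 = -1 by ring,
        show (-1 : ZMod n) - 2 = -3 by ring, hneg 1, hm, add_zero, ← sq, ← frobPow_one hn1,
        ← hm, ← frobPow_add hF, add_neg_cancel, frobPow_zero, map_mul, ← frobPow_add hF] at h
      have h' := congrArg (frobPow F (2 : ZMod n)) h
      rw [map_zero, map_add, map_add, map_add, map_mul, ← frobPow_add hF, ← frobPow_add hF,
        show (2 : ZMod n) + 1 = 3 by ring, show (2 : ZMod n) + (1 + -3) = 0 by ring, hneg,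
        frobPow_zero, show (2 : ZMod n) = 1 + 1 by ring, frobPow_add hF, frobPow_one hn1,
        frobPow_one hn1] at h'
      apply mul_right_cancel₀ ha1
      linear_combination h' - 2 * a 1 ^ 4 * h2
    -- Relation at k = 3: a₃ cancels against a₁φ(a₁) = a₁³.
    have a5 : a (-5) = 0 := by
      have h := hrel 3
      rw [secondDiffCoeff, secondDiffCoeff, if_neg (fun h => n2 (by linear_combination h)),
        if_neg (fun h => n4 (by linear_combination -h)), show (3 : ZMod n) - 2 = 1 by ring,
        show (-3 : ZMod n) - 2 = -5 by ring, add_zero, add_zero, frobPow_one hn1, a3, map_mul,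
        ← frobPow_add hF] at h
      have h' : frobPow F (3 : ZMod n) (a (-5)) * frobPow F (3 + -5 : ZMod n) (a 1) = 0 := by
        linear_combination h - a 1 ^ 3 * h2
      have := (mul_eq_zero.1 h').resolve_right (hfr _)
      simpa using this
    -- For n = 6, −5 = 1 already contradicts a₁ ≠ 0. Otherwise 2 ≠ −4, and `coeff_relation` at (2,
    -- −4) reduces to a₃a₋₃ = 0.
    rcases eq_or_ne n 6 with h6 | h6
    · subst h6
      exact ha1 a5
    · have hpq : (2 : ZMod n) ≠ -4 := by
        intro h
        rcases eq_or_ne n 5 with h5 | h5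
        · subst h5; exact absurd h (by decide)
        · refine hne 6 (by norm_num) (by omega) ?_
          push_cast
          linear_combination h
      have h := coeff_relation hn1 hF hM ha hpq
      rw [if_neg n2, if_neg (neg_ne_zero.2 n4), show (2 : ZMod n) + 1 = 3 by ring,
        show (-4 : ZMod n) + 1 = -3 by ring, show (-4 : ZMod n) - 2 + 1 = -5 by ring,
        show (-4 : ZMod n) - 1 = -5 by ring, a5, map_zero, mul_zero, zero_mul, add_zero, add_zero,
        add_zero, map_eq_zero_iff _ (AlgEquiv.injective _)] at h
      have hm := hneg 3
      rcases mul_eq_zero.1 h with h | h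
      · exact pow_ne_zero 3 ha1 (a3 ▸ h)
      · rw [h, map_zero, a3] at hm
        exact pow_ne_zero 3 ha1 hm.symm
  have hm1 : a (-1) = 0 := by
    have := hneg 1
    rw [ha1] at this
    simpa using this
  have hcoeff : ∀ k : ZMod n, secondDiffCoeff a k = 0 := fun k => by
    simp [secondDiffCoeff, ha1, hm1]
  ext x
  rw [ha, LinearMap.zero_apply]
  refine Finset.sum_eq_zero fun k _ => ?_
  have := hrel k
  rw [hcoeff, hcoeff, map_zero, add_zero, add_zero] at this
  rw [this, zero_mul]

end SecondDifference

/-! ### Conclusion for permutations. -/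

section Permutation

variable {F : Type*} [Field F] [Algebra (ZMod 2) F] {n : ℕ} {L₁ L₂ : F →ₗ[ZMod 2] F}

theorem bijective_inv_swap (h : Function.Bijective (fun x : F => L₁ x⁻¹ + L₂ x)) :
    Function.Bijective (fun x : F => L₂ x⁻¹ + L₁ x) := by
  have := h.comp (inv_involutive (G := F)).bijective
  convert this using 2 with x
  simp [add_comm]

variable [Finite F]

theorem ker_ne_bot_of_bijective (hn : 5 ≤ n) (hF : Nat.card F = 2 ^ n) (hL₂ : L₂ ≠ 0)
    (hperm : Function.Bijective (fun x : F => L₁ x⁻¹ + L₂ x)) : LinearMap.ker L₁ ≠ ⊥ := by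
  intro hker
  have hinj : Function.Injective (traceAdjoint L₁) := by
    rw [← LinearMap.ker_eq_bot, ← Submodule.finrank_eq_zero (R := ZMod 2),
      finrank_ker_traceAdjoint, hker, finrank_bot]
  let e := LinearEquiv.ofBijective (traceAdjoint L₁) ⟨hinj, Finite.surjective_of_injective hinj⟩
  have : NeZero n := ⟨by omega⟩
  -- This is M = L₂* ∘ (L₁*)⁻¹; writing b = L₁*(c) gives bM(b) = L₁*(c)L₂*(c).
  have hM : traceAdjoint L₂ ∘ₗ e.symm.toLinearMap = 0 := by
    refine eq_zero_of_forall_isKloostermanNull hn hF fun b => ?_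
    obtain ⟨c, rfl⟩ := e.surjective b
    have h := isKloostermanNull_of_bijective (by omega) hF hperm c
    have he : e c = traceAdjoint L₁ c := rfl
    rwa [LinearMap.comp_apply, LinearEquiv.coe_coe, LinearEquiv.symm_apply_apply, he]
  apply hL₂
  ext x
  refine eq_zero_of_trace_mul_eq_zero fun y => ?_
  have h := LinearMap.congr_fun hM (e y)
  simp only [LinearMap.comp_apply, LinearEquiv.coe_coe, LinearEquiv.symm_apply_apply,
    LinearMap.zero_apply] at h
  rw [trace_traceAdjoint, h, mul_zero, map_zero]

theorem ker_of_bijective (hn : 5 ≤ n) (hF : Nat.card F = 2 ^ n) (hL₂ : L₂ ≠ 0)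
    (hperm : Function.Bijective (fun x : F => L₁ x⁻¹ + L₂ x)) :
    IsSubfieldTranslate n (LinearMap.ker L₁ : Set F) ∧
    LinearMap.ker L₁ = Submodule.map (traceAdjoint L₂) (LinearMap.ker (traceAdjoint L₁)) := by
  have hK := isKloostermanNull_of_bijective (by omega) hF hperm
  have hV := ker_eq_map_traceAdjoint_of_isKloostermanNull
    (fun _ => eq_zero_of_traceAdjoint_eq_zero hperm) hK
  exact ⟨isSubfieldTranslate_of_sqrt_mul_mem hF _ (ker_ne_bot_of_bijective hn hF hL₂ hperm)
    fun _ _ _ hx hy hz => mem_ker_of_sq_eq_mul_of_isKloostermanNull hV hK hx hy hz, hV⟩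

end Permutation

theorem mainTheorem3 {F : Type*} [Field F] [Finite F] [Algebra (ZMod 2) F]
    (n : ℕ) (hn : 5 ≤ n) (hF : Nat.card F = 2 ^ n)
    (L₁ L₂ : F →ₗ[ZMod 2] F) (hL₁ : L₁ ≠ 0) (hL₂ : L₂ ≠ 0)
    (hperm : Function.Bijective (fun x : F => L₁ x⁻¹ + L₂ x)) :
    IsSubfieldTranslate n (LinearMap.ker L₁ : Set F) ∧
    IsSubfieldTranslate n (LinearMap.ker L₂ : Set F) ∧
    LinearMap.ker L₁ = Submodule.map (traceAdjoint L₂) (LinearMap.ker (traceAdjoint L₁)) ∧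
    LinearMap.ker L₂ = Submodule.map (traceAdjoint L₁) (LinearMap.ker (traceAdjoint L₂)) := by
  have h₁ := ker_of_bijective hn hF hL₂ hperm
  have h₂ := ker_of_bijective hn hF hL₁ (bijective_inv_swap hperm)
  exact ⟨h₁.1, h₂.1, h₁.2, h₂.2⟩
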